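/- Let $p>3$ be a prime and let $$\Phi_8(32)=\langle \alpha_1,\alpha_2,\beta \mid [\alpha_1,\alpha_2]=\beta=\alpha_1^{p},\ \beta^{p^2}=\alpha_2^{p^2}=1\rangle ,\qquad [x,y]=x^{-1}y^{-1}xy .$$ The family $\Phi_8$ is the isoclinism class of $\Phi_8(32)$; here groups $G$ and $H$ are isoclinic if there are isomorphisms $G/Z(G)\cong H/Z(H)$ and $[G,G]\cong [H,H]$ compatible with the commutator maps. For a group $G$ let $$\mathrm{B}_0(G)=\bigcap_{A\le G,\ A\text{ abelian}}\ker\bigl(\mathrm{res}^G_A\colon H^2(G,\mathbb{Q}/\mathbb{Z})\to H^2(A,\mathbb{Q}/\mathbb{Z})\bigr)$$ (trivial action on $\mathbb{Q}/\mathbb{Z}$) be its Bogomolov multiplier. Then $\Phi_8(32)$ has order $p^5$, and if $G$ is any group of order $p^5$ that belongs to the family $\Phi_8$, then $G\cong\Phi_8(32)$ and $\mathrm{B}_0(G)=0$. -/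

import Mathlib

open CategoryTheory commutatorElement

noncomputable section

/-- Isoclinism of groups (P. Hall): there are isomorphisms `φ : G/Z(G) ≃ H/Z(H)` and
`ψ : [G,G] ≃ [H,H]` that are compatible with the commutator maps
`G/Z(G) × G/Z(G) → [G,G]` and `H/Z(H) × H/Z(H) → [H,H]`.  (Because the condition is imposed for all
pairs of elements, it does not matter which of the two usual commutator conventions is used.) -/
def Isoclinic (G : Type*) (H : Type*) [Group G] [Group H] : Prop :=
  ∃ (φ : (G ⧸ Subgroup.center G) ≃* (H ⧸ Subgroup.center H))
    (ψ : commutator G ≃* commutator H),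
    ∀ (x y : G) (x' y' : H),
      φ (QuotientGroup.mk x) = QuotientGroup.mk x' →
      φ (QuotientGroup.mk y) = QuotientGroup.mk y' →
      ψ ⟨⁅x, y⁆, Subgroup.commutator_mem_commutator (Subgroup.mem_top x) (Subgroup.mem_top y)⟩ =
        ⟨⁅x', y'⁆,
          Subgroup.commutator_mem_commutator (Subgroup.mem_top x') (Subgroup.mem_top y')⟩

namespace Phi8

/-- The three generators `α₁, α₂, β` of the presentation of `Φ₈(32)`. -/
inductive Gen : Type
  | α₁ : Gen
  | α₂ : Gen
  | β : Gen

/-- The generator `α₁` as an element of the free group. -/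
def a₁ : FreeGroup Gen := FreeGroup.of Gen.α₁

/-- The generator `α₂` as an element of the free group. -/
def a₂ : FreeGroup Gen := FreeGroup.of Gen.α₂

/-- The generator `β` as an element of the free group. -/
def b : FreeGroup Gen := FreeGroup.of Gen.β

/-- The relators of `Φ₈(32)`: they say `[α₁, α₂] = β = α₁ ^ p` and `β ^ p² = α₂ ^ p² = 1`, where
`[x, y] = x⁻¹ y⁻¹ x y`. -/
def rels (p : ℕ) : Set (FreeGroup Gen) :=
  {(a₁⁻¹ * a₂⁻¹ * a₁ * a₂) * b⁻¹, a₁ ^ p * b⁻¹, b ^ (p ^ 2), a₂ ^ (p ^ 2)}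

end Phi8

/-- The group
`Φ₈(32) = ⟨α₁, α₂, β ∣ [α₁, α₂] = β = α₁ ^ p, β ^ p² = α₂ ^ p² = 1⟩`. -/
abbrev Phi8_32 (p : ℕ) : Type := PresentedGroup (Phi8.rels p)

/-- `G` is a group of order `p ^ 5` that belongs to the isoclinism family `Φ₈`, that is, to the
isoclinism class of `Φ₈(32)`. -/
def IsPhi8Group (p : ℕ) (G : Type*) [Group G] : Prop :=
  Nat.card G = p ^ 5 ∧ Isoclinic G (Phi8_32 p)

universe u

/-- `ℚ/ℤ` as a `G`-module with trivial action.  (The `ULift`s only move `ℤ` and `ℚ/ℤ` to the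
universe of `G`.) -/
abbrev QmodZ (G : Type u) [Group G] : Rep.{u} (ULift.{u} ℤ) G :=
  Rep.trivial (ULift.{u} ℤ) G (ULift.{u} (AddCircle (1 : ℚ)))

/-- The restriction map `H²(G, ℚ/ℤ) → H²(A, ℚ/ℤ)` to a subgroup `A` of `G`. -/
def resQmodZ (G : Type u) [Group G] (A : Subgroup G) :
    groupCohomology (QmodZ G) 2 ⟶ groupCohomology (QmodZ A) 2 :=
  groupCohomology.map (A := QmodZ G) (B := QmodZ A) A.subtype (𝟙 (QmodZ A)) 2

/-- The Bogomolov multiplier `B₀(G)`: the intersection, over all abelian subgroups `A` of `G`, of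
the kernels of the restriction maps `H²(G, ℚ/ℤ) → H²(A, ℚ/ℤ)`. -/
def bogomolovMultiplier (G : Type u) [Group G] :
    Submodule (ULift.{u} ℤ) (groupCohomology (QmodZ G) 2) :=
  ⨅ (A : Subgroup G) (_ : ∀ x ∈ A, ∀ y ∈ A, x * y = y * x), LinearMap.ker (resQmodZ G A).hom

end

/-! ### Arithmetic of `1 + p` modulo `p ^ 3` -/

/-! Eliminating `β` presents `Φ₈(32)` as the split metacyclic group `ℤ/p³ ⋊ ℤ/p²`, generated by `x`,
`y` with `y⁻¹xy = x^(1+p)`. Since `1 + p` has order exactly `p²` modulo `p³`, every element is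
uniquely `y^j x^i`, which gives the order `p⁵` and the centre `⟨x^(p²)⟩` of order `p`.

An isoclinism transports these relations to `G` modulo its centre, which is `⟨c^p⟩` for the
commutator `c` of the lifted generators. Replacing `y` by a power times a power of `x` makes them
exact (`exists_isPhi8Pair_of_center`), and counting gives `G ≅ Φ₈(32)`.

`B₀` vanishes because all of `H²(G, ℚ/ℤ)` does: the relations lift to every central extension by a
divisible group (`IsPhi8Pair.exists_lift`), so each such extension splits and each cocycle is a
coboundary. -/

theorem emultiplicity_one_add_prime_pow_sub_one {p : ℕ} (hp : p.Prime) (hp3 : 3 < p) (j : ℕ) :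
    emultiplicity (p : ℤ) ((1 + p : ℤ) ^ j - 1) = 1 + emultiplicity p j := by
  have hodd : Odd p := hp.odd_of_ne_two (by omega)
  have hpZ : Prime (p : ℤ) := Nat.prime_iff_prime_int.mp hp
  have h := Int.emultiplicity_pow_sub_pow hp hodd (x := 1 + p) (y := 1) (by simp)
    (fun h => hpZ.not_dvd_one ((dvd_add_left (dvd_refl (p : ℤ))).mp h)) j
  rw [one_pow] at h
  rw [h, add_sub_cancel_left]
  congr 1
  have := emultiplicity_pow_self (p := (p : ℤ)) hpZ.ne_zero hpZ.not_isUnit 1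
  simpa using this

theorem prime_cube_dvd_one_add_pow_sub_one_iff {p : ℕ} (hp : p.Prime) (hp3 : 3 < p) (j : ℕ) :
    (p : ℤ) ^ 3 ∣ (1 + p : ℤ) ^ j - 1 ↔ p ^ 2 ∣ j := by
  rw [pow_dvd_iff_le_emultiplicity, pow_dvd_iff_le_emultiplicity,
    emultiplicity_one_add_prime_pow_sub_one hp hp3]
  rw [show ((3 : ℕ) : ℕ∞) = 1 + (2 : ℕ) by norm_num]
  exact (ENat.add_le_add_iff_left (ENat.natCast_ne_top 1))

theorem not_prime_pow_four_dvd_one_add_pow_sub_one {p : ℕ} (hp : p.Prime) (hp3 : 3 < p) :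
    ¬ (p : ℤ) ^ 4 ∣ (1 + p : ℤ) ^ (p ^ 2) - 1 := by
  rw [pow_dvd_iff_le_emultiplicity, emultiplicity_one_add_prime_pow_sub_one hp hp3,
    emultiplicity_pow_self hp.ne_zero hp.prime.not_isUnit]
  norm_num

/-- A truncated binomial theorem. -/
theorem one_add_mul_pow_of_cube_eq_zero {R : Type*} [CommRing R] {q : R} (hq : q ^ 3 = 0)
    (a : R) (n : ℕ) :
    (1 + q * a) ^ n = 1 + n * (q * a) + n.choose 2 * (q ^ 2 * a ^ 2) := by
  induction n with
  | zero => simp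
  | succ n ih =>
    rw [pow_succ, ih, Nat.choose_succ_succ' n 1, Nat.choose_one_right]
    push_cast
    linear_combination (n.choose 2 * a ^ 3) * hq

theorem prime_dvd_choose_two {p : ℕ} (hp : p.Prime) (hp3 : 3 < p) {n : ℕ} (h : p ∣ n) :
    p ∣ n.choose 2 := by
  have h2 : p ∣ n.choose 2 * 2 := by
    rw [Nat.choose_two_right,
      Nat.div_mul_cancel (even_iff_two_dvd.mp (Nat.even_mul_pred_self n))]
    exact h.mul_right _
  exact ((hp.dvd_mul).mp h2).resolve_right fun h => by
    have := Nat.le_of_dvd (by norm_num) h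
    omega

/-- Modulo `p³` the quadratic binomial term drops out because `p` divides `(pk).choose 2`; the
surviving corrections `-p²k` and `+p²k` cancel. This is what normalises the conjugation exponent to
`1 + p`. -/
theorem prime_cube_dvd_adjusted_pow {p : ℕ} (hp : p.Prime) (hp3 : 3 < p) (k : ℕ) :
    (p : ℤ) ^ 3 ∣ (1 + p * (1 - p * k) : ℤ) ^ (1 + p * k) - (1 + p) := by
  have hq : ((p : ℤ) : ZMod (p ^ 3)) ^ 3 = 0 := by
    have := ZMod.natCast_self (p ^ 3)
    push_cast at this ⊢
    exact this
  have key : (((1 + p * (1 - p * k) : ℤ) ^ (1 + p * k) - (1 + p) : ℤ) : ZMod (p ^ 3)) = 0 := by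
    obtain ⟨m, hm⟩ := prime_dvd_choose_two hp hp3 (dvd_mul_right p k)
    push_cast at hq ⊢
    rw [pow_add, pow_one, one_add_mul_pow_of_cube_eq_zero hq, hm]
    push_cast
    linear_combination ((1 + p * (1 - p * k)) * (-k ^ 2 + m * (1 - p * k) ^ 2)
      + k - p * k ^ 2 : ZMod (p ^ 3)) * hq
  rw [ZMod.intCast_zmod_eq_zero_iff_dvd] at key
  exact_mod_cast key

theorem geom_sum_one_add_of_cube_eq_zero {R : Type*} [CommRing R] {q : R} (hq : q ^ 3 = 0)
    (n : ℕ) :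
    ∑ i ∈ Finset.range n, (1 + q) ^ i = n + n.choose 2 * q + n.choose 3 * q ^ 2 := by
  induction n with
  | zero => simp
  | succ n ih =>
    have := one_add_mul_pow_of_cube_eq_zero hq 1 n
    rw [mul_one] at this
    rw [Finset.sum_range_succ, ih, this, Nat.choose_succ_succ' n 1, Nat.choose_one_right,
      Nat.choose_succ_succ' n 2]
    push_cast
    ring

/-- Used to see that `(y x^s)^(p²) = y^(p²) x^(p² s)` when `x` has exponent `p³`. The binomial
corrections vanish since `p²` divides `(p²).choose 2` and `p` divides `(p²).choose 3`. -/
theorem prime_cube_dvd_geom_sum_sub {p : ℕ} (hp : p.Prime) (hp3 : 3 < p) :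
    (p : ℤ) ^ 3 ∣ (∑ i ∈ Finset.range (p ^ 2), (1 + p : ℤ) ^ i) - p ^ 2 := by
  have hq : ((p : ℤ) : ZMod (p ^ 3)) ^ 3 = 0 := by
    have := ZMod.natCast_self (p ^ 3)
    push_cast at this ⊢
    exact this
  have key : (((∑ i ∈ Finset.range (p ^ 2), (1 + p : ℤ) ^ i) - p ^ 2 : ℤ) : ZMod (p ^ 3)) = 0 := by
    have h2 : p ^ 2 ∣ (p ^ 2).choose 2 := by
      have h2 : p ^ 2 ∣ (p ^ 2).choose 2 * 2 := by
        rw [Nat.choose_two_right,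
          Nat.div_mul_cancel (even_iff_two_dvd.mp (Nat.even_mul_pred_self _))]
        exact dvd_mul_right _ _
      refine Nat.Coprime.dvd_of_dvd_mul_right (Nat.Coprime.pow_left 2 ?_) h2
      exact (Nat.coprime_primes hp Nat.prime_two).mpr (by omega)
    obtain ⟨m, hm⟩ := h2
    obtain ⟨l, hl⟩ := hp.dvd_choose_pow (n := 2) (k := 3) (by norm_num)
      (by nlinarith)
    push_cast at hq ⊢
    rw [geom_sum_one_add_of_cube_eq_zero hq, hm, hl]
    push_cast
    linear_combination (m + l : ZMod (p ^ 3)) * hq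
  rw [ZMod.intCast_zmod_eq_zero_iff_dvd] at key
  exact_mod_cast key

/-! ### Conjugation by powers -/

section ConjPow

variable {G : Type*} [Group G] {x y : G} {v : ℤ}

theorem zpow_mul_of_conj (h : y⁻¹ * x * y = x ^ v) (m : ℤ) : x ^ m * y = y * x ^ (m * v) := by
  have h1 := conj_zpow (a := y⁻¹) (b := x) (i := m)
  rw [inv_inv, h, ← zpow_mul, mul_comm v m] at h1
  rw [h1]
  group

theorem zpow_mul_pow_of_conj (h : y⁻¹ * x * y = x ^ v) (m : ℤ) (n : ℕ) :
    x ^ m * y ^ n = y ^ n * x ^ (m * v ^ n) := by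
  induction n with
  | zero => simp
  | succ n ih =>
    rw [pow_succ, ← mul_assoc, ih, mul_assoc, zpow_mul_of_conj h, pow_succ]
    simp only [mul_assoc]

theorem conj_pow_of_conj (h : y⁻¹ * x * y = x ^ v) (n : ℕ) :
    (y ^ n)⁻¹ * x * y ^ n = x ^ (v ^ n) := by
  have := zpow_mul_pow_of_conj h 1 n
  rw [zpow_one, one_mul] at this
  rw [mul_assoc, this, inv_mul_cancel_left]

theorem mul_zpow_pow_of_conj (h : y⁻¹ * x * y = x ^ v) (s : ℤ) (n : ℕ) :
    (y * x ^ s) ^ n = y ^ n * x ^ (s * ∑ i ∈ Finset.range n, v ^ i) := by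
  induction n with
  | zero => simp
  | succ n ih =>
    rw [pow_succ, ih, geom_sum_succ, pow_succ]
    rw [show y ^ n * x ^ (s * ∑ i ∈ Finset.range n, v ^ i) * (y * x ^ s) =
      y ^ n * (x ^ (s * ∑ i ∈ Finset.range n, v ^ i) * y) * x ^ s by simp only [mul_assoc],
      zpow_mul_of_conj h]
    rw [← mul_assoc, mul_assoc, ← zpow_add]
    congr 2
    ring

end ConjPow

/-! ### Normal form, centre and order -/

/-- The pair `(x, y)` satisfies the defining relations of `Φ₈(32)`, with `β = x ^ p` eliminated. -/
structure IsPhi8Pair (p : ℕ) {G : Type*} [Group G] (x y : G) : Prop where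
  pow_left : x ^ p ^ 3 = 1
  pow_right : y ^ p ^ 2 = 1
  conj : y⁻¹ * x * y = x ^ (1 + p : ℤ)

namespace IsPhi8Pair

variable {p : ℕ} {G : Type*} [Group G] {x y : G}

theorem exists_eq_of_mem_closure (hp : p.Prime) (h : IsPhi8Pair p x y) {g : G}
    (hg : g ∈ Subgroup.closure {x, y}) : ∃ (j : ℕ) (i : ℤ), g = y ^ j * x ^ i := by
  induction hg using Subgroup.closure_induction_left with
  | one => exact ⟨0, 0, by simp⟩
  | mul_left a ha g _ ih =>
    obtain ⟨j, i, rfl⟩ := ih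
    rcases ha with rfl | rfl
    · refine ⟨j, (1 + p) ^ j + i, ?_⟩
      have := zpow_mul_pow_of_conj h.conj 1 j
      rw [zpow_one, one_mul] at this
      rw [← mul_assoc, this, mul_assoc, ← zpow_add]
    · exact ⟨j + 1, i, by rw [pow_succ', mul_assoc]⟩
  | inv_mul_cancel a ha g _ ih =>
    obtain ⟨j, i, rfl⟩ := ih
    rcases ha with rfl | rfl
    · refine ⟨j, -(1 + p) ^ j + i, ?_⟩
      have := zpow_mul_pow_of_conj h.conj (-1) j
      rw [zpow_neg_one, neg_one_mul] at this
      rw [← mul_assoc, this, mul_assoc, ← zpow_add]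
    · refine ⟨p ^ 2 - 1 + j, i, ?_⟩
      have : a⁻¹ = a ^ (p ^ 2 - 1) := by
        rw [inv_eq_iff_mul_eq_one, ← pow_succ',
          Nat.sub_add_cancel (Nat.one_le_pow _ _ hp.pos), h.pow_right]
      rw [this, pow_add, mul_assoc]

variable (hp : p.Prime) (hp3 : 3 < p) (h : IsPhi8Pair p x y) (hx : orderOf x = p ^ 3)
include hp hp3 h hx

theorem dvd_of_commute {j : ℕ} (hj : Commute x (y ^ j)) : p ^ 2 ∣ j := by
  rw [← prime_cube_dvd_one_add_pow_sub_one_iff hp hp3]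
  have h1 := conj_pow_of_conj h.conj j
  rw [mul_assoc, hj.eq, inv_mul_cancel_left] at h1
  have h2 : x ^ ((1 + p : ℤ) ^ j - 1) = 1 := by
    rw [zpow_sub, ← h1, zpow_one, mul_inv_cancel]
  have := orderOf_dvd_iff_zpow_eq_one.mpr h2
  rw [hx] at this
  exact_mod_cast this

/-- A power of `y` lying in `⟨x⟩` commutes with `x`, hence is trivial; this is uniqueness of the
normal form. -/
theorem dvd_of_mul_eq_one {j : ℕ} {i : ℤ} (hij : y ^ j * x ^ i = 1) :
    p ^ 2 ∣ j ∧ (p : ℤ) ^ 3 ∣ i := by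
  have hj : p ^ 2 ∣ j := by
    apply h.dvd_of_commute hp hp3 hx
    rw [eq_inv_of_mul_eq_one_left hij]
    exact ((Commute.refl x).zpow_right i).inv_right
  refine ⟨hj, ?_⟩
  obtain ⟨m, rfl⟩ := hj
  rw [pow_mul, h.pow_right, one_pow, one_mul] at hij
  have := orderOf_dvd_iff_zpow_eq_one.mpr hij
  rw [hx] at this
  exact_mod_cast this

theorem center_eq (hG : Subgroup.closure {x, y} = ⊤) :
    Subgroup.center G = Subgroup.zpowers (x ^ p ^ 2) := by
  apply le_antisymm
  · intro z hz
    rw [Subgroup.mem_center_iff] at hz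
    obtain ⟨j, i, rfl⟩ := h.exists_eq_of_mem_closure hp (g := z) (hG ▸ Subgroup.mem_top z)
    have hj : p ^ 2 ∣ j := by
      apply h.dvd_of_commute hp hp3 hx
      have h1 : Commute x (y ^ j * x ^ i) := hz x
      have h2 := h1.mul_right ((Commute.refl x).zpow_right (-i))
      rwa [mul_assoc, ← zpow_add, add_neg_cancel, zpow_zero, mul_one] at h2
    obtain ⟨m, rfl⟩ := hj
    rw [pow_mul, h.pow_right, one_pow, one_mul] at hz ⊢
    have h1 := zpow_mul_of_conj h.conj i
    rw [← hz y] at h1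
    -- Commuting with `y` forces `x^(ip) = 1`, so `p²` divides `i`.
    have h2 : x ^ (i * (1 + p : ℤ) - i) = 1 := by
      rw [zpow_sub, ← mul_left_cancel h1, mul_inv_cancel]
    have h3 := orderOf_dvd_iff_zpow_eq_one.mpr h2
    rw [hx, show i * (1 + p : ℤ) - i = i * p by ring, Nat.cast_pow, pow_succ] at h3
    obtain ⟨t, rfl⟩ := Int.dvd_of_mul_dvd_mul_right (by exact_mod_cast hp.ne_zero) h3
    refine ⟨t, ?_⟩
    dsimp only
    rw [← zpow_natCast, ← zpow_mul, Nat.cast_pow]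
  · rw [Subgroup.zpowers_le, Subgroup.mem_center_iff]
    have hxz : Commute x (x ^ p ^ 2) := (Commute.refl x).pow_right _
    have hyz : Commute y (x ^ p ^ 2) := by
      have h1 := zpow_mul_of_conj h.conj (p ^ 2 : ℕ)
      have h2 : ((p ^ 2 : ℕ) : ℤ) * (1 + p) = (p ^ 2 : ℕ) + (p ^ 3 : ℕ) := by push_cast; ring
      rw [h2, zpow_add, zpow_natCast, zpow_natCast, h.pow_left, mul_one] at h1
      exact h1.symm
    intro g
    obtain ⟨j, i, rfl⟩ := h.exists_eq_of_mem_closure hp (g := g) (hG ▸ Subgroup.mem_top g)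
    exact (hyz.pow_left j).mul_left (hxz.zpow_left i)

theorem card_eq (hG : Subgroup.closure {x, y} = ⊤) : Nat.card G = p ^ 5 := by
  let f : Fin (p ^ 2) × Fin (p ^ 3) → G := fun a => y ^ (a.1 : ℕ) * x ^ (a.2 : ℕ)
  have hf : Function.Bijective f := by
    constructor
    · have key : ∀ (j j' i i' : ℕ), j < p ^ 2 → i < p ^ 3 → i' < p ^ 3 → j' ≤ j →
          y ^ j * x ^ i = y ^ j' * x ^ i' → j = j' ∧ i = i' := by
        intro j j' i i' hj hi hi' hjj he
        obtain ⟨l, rfl⟩ := Nat.exists_eq_add_of_le hjj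
        rw [pow_add, mul_assoc] at he
        have h1 : y ^ l * x ^ ((i : ℤ) - i') = 1 := by
          rw [zpow_sub, zpow_natCast, zpow_natCast, ← mul_assoc, mul_left_cancel he,
            mul_inv_cancel]
        obtain ⟨h2, h3⟩ := h.dvd_of_mul_eq_one hp hp3 hx h1
        have h4 : l = 0 := Nat.eq_zero_of_dvd_of_lt h2 (by omega)
        have h5 : (i : ℤ) - i' = 0 := by
          apply Int.eq_zero_of_abs_lt_dvd h3
          rw [abs_lt]
          have h6 : (i : ℤ) < (p : ℤ) ^ 3 := by exact_mod_cast hi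
          have h7 : (i' : ℤ) < (p : ℤ) ^ 3 := by exact_mod_cast hi'
          omega
        omega
      rintro ⟨j, i⟩ ⟨j', i'⟩ he
      have : (j : ℕ) = j' ∧ (i : ℕ) = i' := by
        rcases le_total (j' : ℕ) j with hle | hle
        · exact key _ _ _ _ j.2 i.2 i'.2 hle he
        · obtain ⟨h1, h2⟩ := key _ _ _ _ j'.2 i'.2 i.2 hle he.symm
          exact ⟨h1.symm, h2.symm⟩
      exact Prod.ext (Fin.ext this.1) (Fin.ext this.2)
    · intro g
      obtain ⟨j, i, rfl⟩ := h.exists_eq_of_mem_closure hp (g := g) (hG ▸ Subgroup.mem_top g)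
      have hp3' : (0 : ℤ) < (p ^ 3 : ℕ) := by exact_mod_cast pow_pos hp.pos 3
      have hn := Int.emod_nonneg i hp3'.ne'
      refine ⟨⟨⟨j % p ^ 2, Nat.mod_lt _ (pow_pos hp.pos 2)⟩,
        ⟨(i % (p ^ 3 : ℕ)).toNat, ?_⟩⟩, ?_⟩
      · have := Int.emod_lt_of_pos i hp3'
        omega
      · dsimp only [f]
        rw [← pow_eq_pow_mod j h.pow_right, ← zpow_natCast x, Int.toNat_of_nonneg hn,
          ← hx, zpow_mod_orderOf]
  rw [← Nat.card_eq_of_bijective f hf, Nat.card_prod, Nat.card_fin, Nat.card_fin]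
  ring

theorem card_center (hG : Subgroup.closure {x, y} = ⊤) : Nat.card (Subgroup.center G) = p := by
  rw [h.center_eq hp hp3 hx hG, Nat.card_zpowers, orderOf_pow' _ (pow_ne_zero 2 hp.ne_zero), hx,
    Nat.gcd_eq_right (pow_dvd_pow p (by norm_num)), Nat.pow_div (by norm_num) hp.pos, pow_one]

end IsPhi8Pair

/-! ### The presented group -/

namespace Phi8

variable {p : ℕ}

theorem isPhi8Pair_of :
    IsPhi8Pair p (PresentedGroup.of Gen.α₁ : Phi8_32 p) (PresentedGroup.of Gen.α₂) := by
  have h1 := PresentedGroup.one_of_mem (rels := rels p) (x := a₁⁻¹ * a₂⁻¹ * a₁ * a₂ * b⁻¹)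
    (by simp [rels])
  have h2 := PresentedGroup.one_of_mem (rels := rels p) (x := a₁ ^ p * b⁻¹) (by simp [rels])
  have h3 := PresentedGroup.one_of_mem (rels := rels p) (x := b ^ p ^ 2) (by simp [rels])
  have h4 := PresentedGroup.one_of_mem (rels := rels p) (x := a₂ ^ p ^ 2) (by simp [rels])
  simp only [map_mul, map_inv, map_pow] at h1 h2 h3 h4
  have e1 : PresentedGroup.mk (rels p) a₁ = PresentedGroup.of Gen.α₁ := rfl
  have e2 : PresentedGroup.mk (rels p) a₂ = PresentedGroup.of Gen.α₂ := rfl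
  rw [e1] at h1 h2
  rw [e2] at h1 h4
  rw [← eq_of_mul_inv_eq_one h2] at h1 h3
  refine ⟨?_, h4, ?_⟩
  · rw [pow_succ', pow_mul, h3]
  · rw [zpow_add, zpow_one, zpow_natCast, ← eq_of_mul_inv_eq_one h1]
    group

theorem of_β : (PresentedGroup.of Gen.β : Phi8_32 p) = PresentedGroup.of Gen.α₁ ^ p := by
  have h2 := PresentedGroup.one_of_mem (rels := rels p) (x := a₁ ^ p * b⁻¹) (by simp [rels])
  rw [map_mul, map_inv, map_pow] at h2
  exact (eq_of_mul_inv_eq_one h2).symm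

theorem closure_eq_top :
    Subgroup.closure {(PresentedGroup.of Gen.α₁ : Phi8_32 p), PresentedGroup.of Gen.α₂} = ⊤ := by
  rw [eq_top_iff]
  have hα : (PresentedGroup.of Gen.α₁ : Phi8_32 p) ∈
      Subgroup.closure {(PresentedGroup.of Gen.α₁ : Phi8_32 p), PresentedGroup.of Gen.α₂} :=
    Subgroup.subset_closure (by simp)
  intro g _
  refine PresentedGroup.generated_by (rels p) _ ?_ g
  rintro (_ | _ | _)
  · exact hα
  · exact Subgroup.subset_closure (by simp)
  · rw [of_β]
    exact pow_mem hα p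

/-- The homomorphism from `Φ₈(32)` given by a pair satisfying its relations. -/
def lift {G : Type*} [Group G] {x y : G} (h : IsPhi8Pair p x y) : Phi8_32 p →* G :=
  PresentedGroup.toGroup (f := fun | .α₁ => x | .α₂ => y | .β => x ^ p) <| by
    have hc : x⁻¹ * y⁻¹ * x * y = x ^ p := by
      rw [mul_assoc, mul_assoc, ← mul_assoc y⁻¹, h.conj, zpow_add, zpow_one, zpow_natCast,
        inv_mul_cancel_left]
    rintro r (rfl | rfl | rfl | rfl)
    · simp [a₁, a₂, b, hc]
    · simp [a₁, b]
    · simp only [b, map_pow, FreeGroup.lift_apply_of]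
      rw [← pow_mul, ← pow_succ', h.pow_left]
    · simp [a₂, h.pow_right]

@[simp]
theorem lift_α₁ {G : Type*} [Group G] {x y : G} (h : IsPhi8Pair p x y) :
    lift h (PresentedGroup.of Gen.α₁) = x := PresentedGroup.toGroup.of _

@[simp]
theorem lift_α₂ {G : Type*} [Group G] {x y : G} (h : IsPhi8Pair p x y) :
    lift h (PresentedGroup.of Gen.α₂) = y := PresentedGroup.toGroup.of _

theorem hom_ext {G : Type*} [Group G] {f g : Phi8_32 p →* G}
    (h1 : f (PresentedGroup.of Gen.α₁) = g (PresentedGroup.of Gen.α₁))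
    (h2 : f (PresentedGroup.of Gen.α₂) = g (PresentedGroup.of Gen.α₂)) : f = g := by
  apply PresentedGroup.ext
  rintro (_ | _ | _)
  · exact h1
  · exact h2
  · rw [of_β, map_pow, map_pow, h1]

/-- `Φ₈(32)` acts on `ℤ/p³` by the affine maps `t ↦ t + 1` and `t ↦ (1 + p)⁻¹ t`. -/
theorem exists_isPhi8Pair_perm (hp : p.Prime) (hp3 : 3 < p) :
    ∃ x y : Equiv.Perm (ZMod (p ^ 3)), IsPhi8Pair p x y ∧ ∀ n : ℕ, x ^ n = 1 → p ^ 3 ∣ n := by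
  have hv : IsUnit ((1 + p : ℕ) : ZMod (p ^ 3)) := by
    rw [ZMod.isUnit_iff_coprime]
    exact Nat.Coprime.pow_right 3 (by simp)
  obtain ⟨v, hv⟩ := hv
  have hvp : v ^ p ^ 2 = 1 := by
    apply Units.ext
    have := (prime_cube_dvd_one_add_pow_sub_one_iff hp hp3 (p ^ 2)).mpr dvd_rfl
    have h2 := (ZMod.intCast_zmod_eq_zero_iff_dvd ((1 + p : ℤ) ^ p ^ 2 - 1) (p ^ 3)).mpr
      (by exact_mod_cast this)
    rw [Units.val_pow_eq_pow_val, hv, Units.val_one]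
    push_cast at h2 ⊢
    exact sub_eq_zero.mp h2
  have hx : ∀ n : ℕ, (Equiv.addRight 1 : Equiv.Perm (ZMod (p ^ 3))) ^ n =
      (Equiv.addRight (n : ZMod (p ^ 3)) : Equiv.Perm (ZMod (p ^ 3))) := by
    intro n
    induction n with
    | zero => ext; simp
    | succ n ih =>
      rw [pow_succ (Equiv.addRight _ : Equiv.Perm _), ih]
      ext
      simp [add_assoc, add_comm, add_left_comm]
  have hy : ∀ n : ℕ, (Units.mulLeft v⁻¹ : Equiv.Perm (ZMod (p ^ 3))) ^ n =
      Units.mulLeft (v⁻¹ ^ n) := by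
    intro n
    induction n with
    | zero => ext; simp
    | succ n ih => rw [pow_succ (Units.mulLeft v⁻¹), ih]; ext; simp [pow_succ, mul_assoc]
  -- The inverse of `v` is needed because `y⁻¹xy` sends `t` to `v(v⁻¹t + 1) = t + v`.
  refine ⟨Equiv.addRight 1, Units.mulLeft v⁻¹, ⟨?_, ?_, ?_⟩, ?_⟩
  · rw [hx, ZMod.natCast_self]
    ext; simp
  · rw [hy, inv_pow, hvp]
    ext; simp
  · rw [show (1 + p : ℤ) = ((1 + p : ℕ) : ℤ) by push_cast; rfl, zpow_natCast, hx, mul_assoc,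
      inv_mul_eq_iff_eq_mul]
    apply Equiv.ext
    intro t
    simp [mul_add, ← hv]
  · intro n hn
    rw [hx] at hn
    have := congrArg (fun e : Equiv.Perm (ZMod (p ^ 3)) => e 0) hn
    simp only [Equiv.coe_addRight, zero_add, Equiv.Perm.coe_one, id_eq] at this
    exact (ZMod.natCast_eq_zero_iff n (p ^ 3)).mp this

theorem orderOf_α₁ (hp : p.Prime) (hp3 : 3 < p) :
    orderOf (PresentedGroup.of Gen.α₁ : Phi8_32 p) = p ^ 3 := by
  apply Nat.dvd_antisymm (orderOf_dvd_of_pow_eq_one isPhi8Pair_of.pow_left)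
  obtain ⟨x, y, h, hx⟩ := exists_isPhi8Pair_perm hp hp3
  apply hx
  have := congrArg (lift h) (pow_orderOf_eq_one (PresentedGroup.of Gen.α₁ : Phi8_32 p))
  rwa [map_pow, map_one, lift_α₁] at this

theorem card_eq (hp : p.Prime) (hp3 : 3 < p) : Nat.card (Phi8_32 p) = p ^ 5 :=
  isPhi8Pair_of.card_eq hp hp3 (orderOf_α₁ hp hp3) closure_eq_top

/-- Uniqueness of the normal form makes `lift h` injective, and equality of orders makes it
bijective, so generation by `x` and `y` need not be known beforehand. -/
theorem nonempty_mulEquiv (hp : p.Prime) (hp3 : 3 < p) {G : Type*} [Group G] {x y : G}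
    (h : IsPhi8Pair p x y) (hx : orderOf x = p ^ 3) (hG : Nat.card G = p ^ 5) :
    Nonempty (G ≃* Phi8_32 p) := by
  have hinj : Function.Injective (lift h) := by
    rw [injective_iff_map_eq_one]
    intro g hg
    obtain ⟨j, i, rfl⟩ := isPhi8Pair_of.exists_eq_of_mem_closure hp (g := g)
      (closure_eq_top ▸ Subgroup.mem_top g)
    rw [map_mul, map_pow, map_zpow, lift_α₁, lift_α₂] at hg
    obtain ⟨⟨m, rfl⟩, ⟨l, rfl⟩⟩ := h.dvd_of_mul_eq_one hp hp3 hx hg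
    have h1 := isPhi8Pair_of (p := p).pow_left
    rw [pow_mul, isPhi8Pair_of.pow_right, one_pow, one_mul, zpow_mul,
      show (p : ℤ) ^ 3 = (p ^ 3 : ℕ) by push_cast; rfl, zpow_natCast, h1, one_zpow]
  have : Finite G := Nat.finite_of_card_ne_zero (hG ▸ pow_ne_zero 5 hp.ne_zero)
  exact ⟨(MulEquiv.ofBijective (lift h) (hinj.bijective_of_nat_card_le
    (by rw [hG, card_eq hp hp3]))).symm⟩

end Phi8

/-! ### Groups isoclinic to `Φ₈(32)` -/

/-- The content is that a commutator depends only on the classes of its entries modulo the centre.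
-/
theorem Isoclinic.refl (G : Type*) [Group G] : Isoclinic G G := by
  refine ⟨MulEquiv.refl _, MulEquiv.refl _, fun x y x' y' hx hy => ?_⟩
  rw [MulEquiv.refl_apply, QuotientGroup.eq] at hx hy
  apply Subtype.ext
  change ⁅x, y⁆ = ⁅x', y'⁆
  obtain ⟨z, rfl⟩ : ∃ z, x' = x * z := ⟨_, (mul_inv_cancel_left _ _).symm⟩
  obtain ⟨w, rfl⟩ : ∃ w, y' = y * w := ⟨_, (mul_inv_cancel_left _ _).symm⟩
  rw [inv_mul_cancel_left, Subgroup.mem_center_iff] at hx hy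
  simp only [commutatorElement_def, mul_inv_rev]
  have h1 : x * z * (y * w) = x * y * w * z := by
    rw [mul_assoc x, ← hx (y * w)]; simp only [mul_assoc]
  have h2 : x * z * (y * w) * (z⁻¹ * x⁻¹) = x * y * x⁻¹ * w := by
    rw [h1]
    rw [show x * y * w * z * (z⁻¹ * x⁻¹) = x * y * (w * x⁻¹) by group, ← hy x⁻¹]
    simp only [mul_assoc]
  rw [h2]
  group

/-- A pair satisfying the relations of `Φ₈(32)` modulo the centre can be corrected to one satisfying
them exactly, provided the centre is generated by the `p`-th power of the commutator. -/
theorem exists_isPhi8Pair_of_center {p : ℕ} (hp : p.Prime) (hp3 : 3 < p) {G : Type*} [Group G]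
    {x y c : G} (hc : x⁻¹ * y⁻¹ * x * y = c) (hoc : orderOf c = p ^ 2)
    (hZ : Subgroup.center G = Subgroup.zpowers (c ^ p))
    (hxp : c⁻¹ * x ^ p ∈ Subgroup.center G) (hyp : y ^ p ^ 2 ∈ Subgroup.center G) :
    ∃ y' : G, orderOf x = p ^ 3 ∧ IsPhi8Pair p x y' := by
  have hcp : c ^ p ^ 2 = 1 := hoc ▸ pow_orderOf_eq_one c
  have hfin : IsOfFinOrder (c ^ p) := by
    rw [isOfFinOrder_iff_pow_eq_one]
    exact ⟨p, hp.pos, by rw [← pow_mul, ← sq, hcp]⟩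
  obtain ⟨k, hk⟩ := hfin.mem_powers_iff_mem_zpowers.mpr (hZ ▸ hxp)
  dsimp only at hk
  replace hk : x ^ p = c ^ (1 + p * k) := by
    rw [← pow_mul] at hk
    rw [pow_add, pow_one, hk, mul_inv_cancel_left]
  have hxp2 : x ^ p ^ 2 = c ^ p := by
    rw [sq, pow_mul, hk, ← pow_mul, show (1 + p * k) * p = p + p ^ 2 * k by ring, pow_add,
      pow_mul c (p ^ 2), hcp, one_pow, mul_one]
  have hpx : x ^ p ^ 3 = 1 := by
    rw [pow_succ, pow_mul, hxp2, ← pow_mul, ← sq, hcp]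
  have hox : orderOf x = p ^ 3 := by
    have := Fact.mk hp
    refine orderOf_eq_prime_pow (fun h1 => ?_) hpx
    rw [hxp2] at h1
    have h2 := Nat.le_of_dvd hp.pos (hoc ▸ orderOf_dvd_of_pow_eq_one h1)
    nlinarith [hp.two_le]
  have zpow_congr : ∀ a b : ℤ, (p : ℤ) ^ 3 ∣ a - b → x ^ a = x ^ b := by
    rintro a b ⟨t, ht⟩
    rw [show a = b + ((p ^ 3 : ℕ) : ℤ) * t by push_cast; linarith, zpow_add, zpow_mul,
      zpow_natCast, hpx, one_zpow, mul_one]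
  -- `1 - pk` inverts `1 + pk` modulo `p²`, the order of `c`.
  have hcx : c = x ^ (p * (1 - p * k) : ℤ) := by
    rw [zpow_mul, zpow_natCast, hk, ← zpow_natCast, ← zpow_mul,
      show ((1 + p * k : ℕ) : ℤ) * (1 - p * k) = 1 + ((p ^ 2 : ℕ) : ℤ) * (-k ^ 2) by
        push_cast; ring,
      zpow_add, zpow_mul, zpow_natCast, hcp, one_zpow, zpow_one, mul_one]
  have hconj : y⁻¹ * x * y = x ^ (1 + p * (1 - p * k) : ℤ) := by
    rw [zpow_add, ← hcx, zpow_one, ← hc]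
    group
  have hconj₁ : (y ^ (1 + p * k))⁻¹ * x * y ^ (1 + p * k) = x ^ (1 + p : ℤ) := by
    rw [conj_pow_of_conj hconj]
    exact zpow_congr _ _ (prime_cube_dvd_adjusted_pow hp hp3 k)
  have hy₁ : (y ^ (1 + p * k)) ^ p ^ 2 ∈ Subgroup.zpowers (x ^ p ^ 2) := by
    rw [hxp2, ← hZ, ← pow_mul, mul_comm, pow_mul]
    exact pow_mem hyp _
  obtain ⟨t, ht⟩ := hy₁
  dsimp only at ht
  -- The power `1 + pk` corrects the action on `x`; the factor `x^(-t)` leaves that action alone and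
  -- cancels `(y^(1+pk))^(p²) = x^(p² t)`.
  refine ⟨y ^ (1 + p * k) * x ^ (-t), hox, hpx, ?_, ?_⟩
  · rw [mul_zpow_pow_of_conj hconj₁, ← ht, ← zpow_natCast, ← zpow_mul, ← zpow_add, ← zpow_zero x]
    apply zpow_congr
    obtain ⟨m, hm⟩ := prime_cube_dvd_geom_sum_sub hp hp3
    rw [sub_eq_iff_eq_add] at hm
    rw [hm]
    exact ⟨-t * m, by push_cast; ring⟩
  · rw [show (y ^ (1 + p * k) * x ^ (-t))⁻¹ * x * (y ^ (1 + p * k) * x ^ (-t)) =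
      x ^ t * ((y ^ (1 + p * k))⁻¹ * x * y ^ (1 + p * k)) * x ^ (-t) by group, hconj₁,
      ← zpow_add, ← zpow_add]
    congr 1
    ring

theorem IsPhi8Group.nonempty_mulEquiv {p : ℕ} (hp : p.Prime) (hp3 : 3 < p) {G : Type*} [Group G]
    (hG : IsPhi8Group p G) : Nonempty (G ≃* Phi8_32 p) := by
  obtain ⟨hcard, φ, ψ, hφψ⟩ := hG
  set a₁ : Phi8_32 p := PresentedGroup.of Phi8.Gen.α₁ with ha₁
  set a₂ : Phi8_32 p := PresentedGroup.of Phi8.Gen.α₂ with ha₂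
  have ha : IsPhi8Pair p a₁ a₂ := Phi8.isPhi8Pair_of
  have hoa : orderOf a₁ = p ^ 3 := Phi8.orderOf_α₁ hp hp3
  obtain ⟨x, hx⟩ := QuotientGroup.mk_surjective (φ.symm (QuotientGroup.mk a₁))
  obtain ⟨y, hy⟩ := QuotientGroup.mk_surjective (φ.symm (QuotientGroup.mk a₂))
  rw [MulEquiv.eq_symm_apply] at hx hy
  -- The inverses convert `⁅g, h⁆ = ghg⁻¹h⁻¹` into the convention of the presentation.
  have hca : ⁅a₁⁻¹, a₂⁻¹⁆ = a₁ ^ p := by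
    rw [commutatorElement_def, inv_inv, inv_inv, mul_assoc, mul_assoc, ← mul_assoc a₂⁻¹, ha.conj,
      zpow_add, zpow_one, zpow_natCast, inv_mul_cancel_left]
  have hφc : φ (QuotientGroup.mk ⁅x⁻¹, y⁻¹⁆) = QuotientGroup.mk (a₁ ^ p) := by
    rw [← hca]
    simp only [commutatorElement_def, QuotientGroup.mk_mul, QuotientGroup.mk_inv, map_mul, map_inv,
      hx, hy]
  have hmem : ∀ g : G, φ (QuotientGroup.mk g) = 1 → g ∈ Subgroup.center G := by
    intro g hg
    rwa [EmbeddingLike.map_eq_one_iff, QuotientGroup.eq_one_iff] at hg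
  have hoc : orderOf ⁅x⁻¹, y⁻¹⁆ = p ^ 2 := by
    have h1 := hφψ x⁻¹ y⁻¹ a₁⁻¹ a₂⁻¹
      (by rw [QuotientGroup.mk_inv, map_inv, hx, QuotientGroup.mk_inv])
      (by rw [QuotientGroup.mk_inv, map_inv, hy, QuotientGroup.mk_inv])
    have h2 := MulEquiv.orderOf_eq ψ ⟨⁅x⁻¹, y⁻¹⁆,
      Subgroup.commutator_mem_commutator (Subgroup.mem_top _) (Subgroup.mem_top _)⟩
    rw [h1, ← Subgroup.orderOf_coe, ← Subgroup.orderOf_coe] at h2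
    change orderOf ⁅a₁⁻¹, a₂⁻¹⁆ = orderOf ⁅x⁻¹, y⁻¹⁆ at h2
    rw [← h2, hca, orderOf_pow' _ hp.ne_zero, hoa, Nat.gcd_eq_right (dvd_pow_self p (by norm_num)),
      pow_succ, Nat.mul_div_cancel _ hp.pos]
  have ha_center : a₁ ^ p ^ 2 ∈ Subgroup.center (Phi8_32 p) := by
    rw [ha.center_eq hp hp3 hoa Phi8.closure_eq_top]
    exact Subgroup.mem_zpowers _
  have hcZ : ⁅x⁻¹, y⁻¹⁆ ^ p ∈ Subgroup.center G := by
    apply hmem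
    rw [QuotientGroup.mk_pow, map_pow, hφc, ← QuotientGroup.mk_pow, ← pow_mul, ← sq,
      QuotientGroup.eq_one_iff]
    exact ha_center
  have : Finite G := Nat.finite_of_card_ne_zero (hcard ▸ pow_ne_zero 5 hp.ne_zero)
  -- Both groups have order `p⁵` and isomorphic central quotients, so their centres have equal
  -- order.
  have hcardZ : Nat.card (Subgroup.center G) = p := by
    have h1 := Subgroup.card_eq_card_quotient_mul_card_subgroup (Subgroup.center G)
    have h2 := Subgroup.card_eq_card_quotient_mul_card_subgroup (Subgroup.center (Phi8_32 p))
    rw [ha.card_center hp hp3 hoa Phi8.closure_eq_top, Phi8.card_eq hp hp3,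
      ← Nat.card_congr φ.toEquiv] at h2
    rw [hcard, h2] at h1
    refine (Nat.eq_of_mul_eq_mul_left (Nat.pos_of_ne_zero fun h0 => ?_) h1).symm
    rw [h0, zero_mul] at h2
    exact pow_ne_zero 5 hp.ne_zero h2
  have hZ : Subgroup.center G = Subgroup.zpowers (⁅x⁻¹, y⁻¹⁆ ^ p) := by
    refine (Subgroup.eq_of_le_of_card_ge ((Subgroup.zpowers_le).mpr hcZ) ?_).symm
    rw [hcardZ, Nat.card_zpowers, orderOf_pow' _ hp.ne_zero, hoc,
      Nat.gcd_eq_right (dvd_pow_self p (by norm_num)), sq, Nat.mul_div_cancel _ hp.pos]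
  obtain ⟨y', hox, hpair⟩ := exists_isPhi8Pair_of_center hp hp3 (x := x) (y := y)
    (by rw [commutatorElement_def, inv_inv, inv_inv]) hoc hZ
    (hmem _ (by rw [QuotientGroup.mk_mul, map_mul, QuotientGroup.mk_inv, map_inv, hφc,
      QuotientGroup.mk_pow, QuotientGroup.mk_pow, map_pow, hx, inv_mul_cancel]))
    (hmem _ (by rw [QuotientGroup.mk_pow, map_pow, hy, ← QuotientGroup.mk_pow, ha.pow_right,
      QuotientGroup.mk_one]))
  exact Phi8.nonempty_mulEquiv hp hp3 hpair hox hcard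

/-! ### Central extensions of `Φ₈(32)` by divisible groups -/

theorem IsPhi8Pair.exists_lift {p : ℕ} (hp : p.Prime) (hp3 : 3 < p) {E G : Type*} [Group E]
    [Group G] (π : E →* G) (hπ : Function.Surjective π) (hker : π.ker ≤ Subgroup.center E)
    (hdiv : ∀ n : ℕ, n ≠ 0 → ∀ d ∈ π.ker, ∃ e ∈ π.ker, e ^ n = d) {x y : G}
    (h : IsPhi8Pair p x y) : ∃ X Y : E, π X = x ∧ π Y = y ∧ IsPhi8Pair p X Y := by
  have hcomm : ∀ {d}, d ∈ π.ker → ∀ g, Commute g d := fun hd g =>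
    Subgroup.mem_center_iff.mp (hker hd) g
  obtain ⟨X₀, rfl⟩ := hπ x
  obtain ⟨Y₀, rfl⟩ := hπ y
  -- Passing from `X₀` to `X₀ * e` multiplies the conjugate by `e` and the `(1+p)`-th power by
  -- `e^(1+p)`, so `e^p` must absorb the discrepancy.
  obtain ⟨e, he, hed⟩ := hdiv p hp.ne_zero ((X₀ ^ (1 + p : ℤ))⁻¹ * (Y₀⁻¹ * X₀ * Y₀)) (by
    rw [MonoidHom.mem_ker, map_mul, map_inv, map_zpow, map_mul, map_mul, map_inv, h.conj,
      inv_mul_cancel])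
  obtain ⟨u, hu, huv⟩ := hdiv (p ^ 2) (pow_ne_zero 2 hp.ne_zero) (Y₀ ^ p ^ 2) (by
    rw [MonoidHom.mem_ker, map_pow, h.pow_right])
  have hXπ : π (X₀ * e) = π X₀ := by rw [map_mul, MonoidHom.mem_ker.mp he, mul_one]
  have hYπ : π (Y₀ * u⁻¹) = π Y₀ := by rw [map_mul, map_inv, MonoidHom.mem_ker.mp hu, inv_one,
    mul_one]
  have hY : (Y₀ * u⁻¹) ^ p ^ 2 = 1 := by
    rw [(hcomm hu Y₀).inv_right.mul_pow, inv_pow, huv, mul_inv_cancel]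
  have hconj₀ : Y₀⁻¹ * (X₀ * e) * Y₀ = (X₀ * e) ^ (1 + p : ℤ) := by
    rw [(hcomm he X₀).mul_zpow, zpow_add e, zpow_one, zpow_natCast,
      ((Commute.refl e).pow_right p).eq, hed]
    simp only [mul_assoc, mul_inv_cancel_left, ← (hcomm he Y₀).eq]
  have hconj : (Y₀ * u⁻¹)⁻¹ * (X₀ * e) * (Y₀ * u⁻¹) = (X₀ * e) ^ (1 + p : ℤ) := by
    rw [← hconj₀, mul_inv_rev, inv_inv, mul_assoc, mul_assoc, ← (hcomm hu _).eq]
    simp only [mul_assoc, inv_mul_cancel, mul_one]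
  refine ⟨X₀ * e, Y₀ * u⁻¹, hXπ, hYπ, ?_, hY, hconj⟩
  generalize X₀ * e = X at *
  generalize Y₀ * u⁻¹ = Y at *
  have hw : X ^ p ^ 3 ∈ π.ker := by rw [MonoidHom.mem_ker, map_pow, hXπ, h.pow_left]
  -- Conjugation by `Y` fixes the central element `X^(p³)` but also raises it to the power `1 + p`.
  have h4 : X ^ p ^ 4 = 1 := by
    have h1 := zpow_mul_of_conj hconj (p ^ 3 : ℕ)
    rw [zpow_natCast, ← (hcomm hw Y).eq, show ((p ^ 3 : ℕ) : ℤ) * (1 + p) =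
      (p ^ 3 : ℕ) + (p ^ 4 : ℕ) by push_cast; ring, zpow_add, zpow_natCast, zpow_natCast] at h1
    exact mul_eq_left.mp (mul_left_cancel h1).symm
  -- As `Y^(p²) = 1` acts trivially, this exponent kills `X`; it is not divisible by `p⁴`, so the
  -- order of `X` cannot be `p⁴`.
  have h5 : X ^ ((1 + p : ℤ) ^ p ^ 2 - 1) = 1 := by
    have h1 := conj_pow_of_conj hconj (p ^ 2)
    rw [hY, inv_one, one_mul, mul_one] at h1
    rw [zpow_sub, ← h1, zpow_one, mul_inv_cancel]
  obtain ⟨k, hk, hok⟩ := (Nat.dvd_prime_pow hp).mp (orderOf_dvd_of_pow_eq_one h4)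
  have hk3 : k ≤ 3 := by
    by_contra hk3
    obtain rfl : k = 4 := by omega
    have := orderOf_dvd_iff_zpow_eq_one.mpr h5
    rw [hok, Nat.cast_pow] at this
    exact not_prime_pow_four_dvd_one_add_pow_sub_one hp hp3 this
  exact orderOf_dvd_iff_pow_eq_one.mp (hok ▸ pow_dvd_pow p hk3)

theorem Phi8.exists_splitting {p : ℕ} (hp : p.Prime) (hp3 : 3 < p) {E G : Type*} [Group E]
    [Group G] (e : G ≃* Phi8_32 p) (π : E →* G) (hπ : Function.Surjective π)
    (hker : π.ker ≤ Subgroup.center E)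
    (hdiv : ∀ n : ℕ, n ≠ 0 → ∀ d ∈ π.ker, ∃ e ∈ π.ker, e ^ n = d) :
    ∃ s : G →* E, ∀ g, π (s g) = g := by
  have h : IsPhi8Pair p (e.symm (PresentedGroup.of Gen.α₁)) (e.symm (PresentedGroup.of Gen.α₂)) :=
    ⟨by rw [← map_pow, isPhi8Pair_of.pow_left, map_one],
      by rw [← map_pow, isPhi8Pair_of.pow_right, map_one],
      by rw [← map_inv, ← map_mul, ← map_mul, isPhi8Pair_of.conj, map_zpow]⟩
  obtain ⟨X, Y, hX, hY, hXY⟩ := h.exists_lift hp hp3 π hπ hker hdiv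
  refine ⟨(lift hXY).comp e.toMonoidHom, fun g => ?_⟩
  have : π.comp (lift hXY) = e.symm.toMonoidHom := hom_ext (by simp [hX]) (by simp [hY])
  simpa using DFunLike.congr_fun this (e g)

/-! ### The extension defined by a `2`-cocycle -/

/-- The central extension of `G` by `D` with trivial action defined by a `2`-cocycle `f`. -/
@[ext]
structure CocycleExtension {G D : Type*} [Group G] [AddCommGroup D] (f : G × G → D)
    (hf : ∀ g h j : G, f (g * h, j) + f (g, h) = f (h, j) + f (g, h * j)) where
  /-- The component in the kernel. -/
  fiber : D
  /-- The component in the quotient. -/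
  base : G

namespace CocycleExtension

variable {G D : Type*} [Group G] [AddCommGroup D] {f : G × G → D}
    {hf : ∀ g h j : G, f (g * h, j) + f (g, h) = f (h, j) + f (g, h * j)}

instance : Mul (CocycleExtension f hf) :=
  ⟨fun a b => ⟨a.fiber + b.fiber + f (a.base, b.base), a.base * b.base⟩⟩

/-- The cocycle is not assumed normalised, hence the shift by `f (1, 1)` in the identity and
inverses. -/
instance : One (CocycleExtension f hf) := ⟨⟨-f (1, 1), 1⟩⟩

instance : Inv (CocycleExtension f hf) :=
  ⟨fun a => ⟨-a.fiber - f (a.base⁻¹, a.base) - f (1, 1), a.base⁻¹⟩⟩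

@[simp] theorem mul_fiber (a b : CocycleExtension f hf) :
    (a * b).fiber = a.fiber + b.fiber + f (a.base, b.base) := rfl
@[simp] theorem mul_base (a b : CocycleExtension f hf) : (a * b).base = a.base * b.base := rfl
@[simp] theorem one_fiber : (1 : CocycleExtension f hf).fiber = -f (1, 1) := rfl
@[simp] theorem one_base : (1 : CocycleExtension f hf).base = 1 := rfl
@[simp] theorem inv_fiber (a : CocycleExtension f hf) :
    a⁻¹.fiber = -a.fiber - f (a.base⁻¹, a.base) - f (1, 1) := rfl
@[simp] theorem inv_base (a : CocycleExtension f hf) : a⁻¹.base = a.base⁻¹ := rfl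

include hf in
theorem cocycle_one_left (g : G) : f (1, g) = f (1, 1) := by
  have := hf 1 1 g
  rw [one_mul, one_mul] at this
  exact (add_left_cancel this).symm

include hf in
theorem cocycle_one_right (g : G) : f (g, 1) = f (1, 1) := by
  have := hf g 1 1
  rw [mul_one, mul_one] at this
  exact add_right_cancel this

instance : Group (CocycleExtension f hf) :=
  Group.ofLeftAxioms
    (fun a b c => by
      ext
      · have := hf a.base b.base c.base
        simp only [mul_fiber, mul_base]
        rw [show a.fiber + b.fiber + f (a.base, b.base) + c.fiber + f (a.base * b.base, c.base) =
          a.fiber + b.fiber + c.fiber + (f (a.base * b.base, c.base) + f (a.base, b.base)) by abel,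
          this]
        abel
      · simp [mul_assoc])
    (fun a => by
      ext
      · simp [cocycle_one_left (hf := hf) a.base]
      · simp)
    (fun a => by
      ext
      · simp only [mul_fiber, inv_fiber, inv_base, one_fiber]
        abel
      · simp)

/-- The projection of the extension onto the quotient. -/
@[simps]
def proj : CocycleExtension f hf →* G where
  toFun := base
  map_one' := rfl
  map_mul' _ _ := rfl

theorem proj_surjective : Function.Surjective (proj (hf := hf)) := fun g => ⟨⟨0, g⟩, rfl⟩

theorem ker_proj_le_center : (proj (hf := hf)).ker ≤ Subgroup.center _ := by
  rintro ⟨d, g⟩ hg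
  obtain rfl : g = 1 := hg
  rw [Subgroup.mem_center_iff]
  intro a
  ext
  · simp [cocycle_one_left (hf := hf) a.base, cocycle_one_right (hf := hf) a.base, add_comm]
  · simp

theorem exists_pow_eq_of_mem_ker_proj
    (hdiv : ∀ n : ℕ, n ≠ 0 → ∀ d : D, ∃ e : D, n • e = d) (n : ℕ) (hn : n ≠ 0)
    (d : CocycleExtension f hf) (hd : d ∈ (proj (hf := hf)).ker) :
    ∃ e ∈ (proj (hf := hf)).ker, e ^ n = d := by
  obtain ⟨d, g⟩ := d
  obtain rfl : g = 1 := hd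
  -- The kernel is identified with `D` by `d ↦ d + f (1, 1)`, so division takes place after this
  -- shift.
  obtain ⟨e, he⟩ := hdiv n hn (d + f (1, 1))
  refine ⟨⟨e - f (1, 1), 1⟩, rfl, ?_⟩
  have key : ∀ m : ℕ, (⟨e - f (1, 1), 1⟩ : CocycleExtension f hf) ^ m =
      ⟨m • e - f (1, 1), 1⟩ := by
    intro m
    induction m with
    | zero => ext <;> simp
    | succ m ih =>
      rw [pow_succ, ih]
      ext
      · simp only [mul_fiber, add_smul, one_smul]
        abel
      · simp
  rw [key, he, add_sub_cancel_right]

end CocycleExtension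

/-! ### Vanishing of the second cohomology -/

theorem Phi8.exists_eq_coboundary {p : ℕ} (hp : p.Prime) (hp3 : 3 < p) {G D : Type*} [Group G]
    [AddCommGroup D] (e : G ≃* Phi8_32 p) (hdiv : ∀ n : ℕ, n ≠ 0 → ∀ d : D, ∃ e : D, n • e = d)
    (f : G × G → D) (hf : ∀ g h j : G, f (g * h, j) + f (g, h) = f (h, j) + f (g, h * j)) :
    ∃ c : G → D, ∀ g h, f (g, h) = c h - c (g * h) + c g := by
  obtain ⟨s, hs⟩ := Phi8.exists_splitting hp hp3 e (CocycleExtension.proj (hf := hf))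
    CocycleExtension.proj_surjective CocycleExtension.ker_proj_le_center
    (CocycleExtension.exists_pow_eq_of_mem_ker_proj hdiv)
  -- Multiplicativity of the section `s`, read in the fibre, is the coboundary identity up to this
  -- sign.
  refine ⟨fun g => -(s g).fiber, fun g h => ?_⟩
  have h1 := congrArg CocycleExtension.fiber (map_mul s g h)
  have hg : (s g).base = g := hs g
  have hh : (s h).base = h := hs h
  rw [CocycleExtension.mul_fiber, hg, hh] at h1
  dsimp only
  rw [h1]
  abel

theorem Phi8.groupCohomology_two_eq_zero {p : ℕ} (hp : p.Prime) (hp3 : 3 < p) {G : Type u}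
    [Group G] (e : G ≃* Phi8_32 p) (z : groupCohomology (QmodZ G) 2) : z = 0 := by
  induction z using groupCohomology.H2_induction_on with
  | h f =>
    rw [groupCohomology.H2π_eq_zero_iff]
    obtain ⟨c, hc⟩ := Phi8.exists_eq_coboundary hp hp3 e (D := ULift.{u} (AddCircle (1 : ℚ)))
      (fun n hn d => ⟨⟨DivisibleBy.div d.down (n : ℤ)⟩, by
        apply ULift.down_injective
        have := DivisibleBy.div_cancel (A := AddCircle (1 : ℚ)) (α := ℤ) d.down
          (Nat.cast_ne_zero.mpr hn : (n : ℤ) ≠ 0)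
        rwa [natCast_zsmul] at this⟩)
      f ((groupCohomology.mem_cocycles₂_iff (A := QmodZ G) f).mp f.2)
    refine ⟨c, ?_⟩
    ext ⟨g, h⟩
    rw [groupCohomology.d₁₂_hom_apply]
    exact congrArg ULift.down (hc g h).symm

theorem proposition3p6 (p : ℕ) (hp : p.Prime) (hp3 : 3 < p) :
    IsPhi8Group p (Phi8_32 p) ∧
      ∀ (G : Type*) [Group G], IsPhi8Group p G →
        Nonempty (G ≃* Phi8_32 p) ∧ bogomolovMultiplier G = ⊥ := by
  refine ⟨⟨Phi8.card_eq hp hp3, Isoclinic.refl _⟩, fun G _ hG => ?_⟩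
  obtain ⟨e⟩ := hG.nonempty_mulEquiv hp hp3
  exact ⟨⟨e⟩, (Submodule.eq_bot_iff _).mpr fun z _ =>
    Phi8.groupCohomology_two_eq_zero hp hp3 e z⟩
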